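/- Let the dodecagrid be the tessellation $\{5,3,4\}$ of hyperbolic $3$-space by right-angled dodecahedra. The cells of a cellular automaton on it are the tiles, and the twelve neighbours of a cell are the tiles that share a face with it. The faces of a dodecahedron are numbered $0,\dots,11$ so that $0$ is surrounded in cyclic order by $1,\dots,5$, its opposite face $11$ is surrounded in the same direction by $6,\dots,10$, and face $6$ shares edges with faces $5$ and $1$. This numbering is carried to every tile by an orientation-preserving isometry. The states are $W$ (blank), $B$, $R$, $G$, $Y$. A rule $S_o\,.\,S_0\cdots S_{11}\,.\,S_n$ says that a cell in state $S_o$ whose $i$-neighbour is in state $S_i$ for every $i$ takes the new state $S_n$. A rotated form of it is $S_o\,.\,S_{\rho(0)}\cdots S_{\rho(11)}\,.\,S_n$, where $\rho$ is the permutation of the faces induced by one of the rotations leaving the dodecahedron invariant. A (rotation invariant) cellular automaton $A$ is given by a program, that is, a set of rules. The rules applied to the cells are the rules of the program and all their rotated forms; they never prescribe two different new states for the same state and neighbourhood. It is not required that every neighbourhood be covered by a rule. In one step all cells are updated simultaneously, each by a rule that matches it; the step exists only if each cell is matched by a rule. The computation halts if two successive configurations are identical. The program is rotationally coherent if no two distinct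 rules of it are rotated forms of each other. Suppose that the program of $A$ is rotationally coherent and that, up to rotation, it contains the following $39$ rules, which leave a blank cell blank. In each of them $S_o=S_n=W$, $S_i=W$ for $i\ge 3$, and $S_0S_1S_2$ is one of $$WWW;\quad BWW, RWW, GWW, YWW;$$ $$BBW, GGW, RRW, YYW, RBW, RYW, GBW, GRW, GYW, YBW;$$ $$BBB, RRR, GGG, YYY, BBR, BBG, BBY, RRB, RRG, RRY, GGB, GGR, GGY, YYB, YYR, YYG;$$ $$BRG, BRY, BGR, BGY, BYR, BYG, RGY, RYG.$$ Then: 1. The halting of the computation of $A$ from a finite configuration is decidable. That is, there is an algorithm that, given a finite list of cells and states (each cell being described by the sequence of face numbers $i$ of the initial dodecahedron such that successively crossing the images of these faces, under the reflections of the tessellation, leads from the initial tile to the cell; for a cell listed several times its first entry counts, and all cells not listed are blank), decides whether the computation of $A$ from this configuration halts. 2. If all non-blank cells of a configuration lie in a ball (for the distance that counts steps from neighbour to neighbour), then all non-blank cells of every configuration that $A$ computes from it lie in the same ball. 3. Every infinite computation of $A$ from a configuration with finitely many non-blank cells is eventually periodic (with period $1$ exactly when it halts). -/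

import Mathlib

/-! # Cellular automata on the dodecagrid, the tessellation {5,3,4} of hyperbolic 3-space -/

namespace Dodecagrid

noncomputable section

/-! ## Hyperbolic 3-space (hyperboloid model) and the dodecagrid -/

/-- Minkowski space of signature (3,1). -/
abbrev Mink := Fin 4 → ℝ

/-- The Minkowski form. -/
def form (x y : Mink) : ℝ := x 0 * y 0 + x 1 * y 1 + x 2 * y 2 - x 3 * y 3

/-- Hyperbolic 3-space: the upper sheet of the hyperboloid. -/
def hyperbolicSpace : Set Mink := {x | form x x = -1 ∧ 0 < x 3}

/-- The directions of the twelve faces of a regular dodecahedron centred at the origin, that is,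
the vertices of a regular icosahedron. Face `0` is surrounded by `1, 2, 3, 4, 5` in this cyclic
order, its opposite face `11` by `6, 7, 8, 9, 10`; face `6` shares edges with faces `5` and `1`. -/
def faceAxis : Fin 12 → Fin 3 → ℝ :=
  let φ := Real.goldenRatio
  ![![0, 1, φ], ![0, -1, φ], ![φ, 0, 1], ![1, φ, 0], ![-1, φ, 0], ![-φ, 0, 1],
    ![-1, -φ, 0], ![1, -φ, 0], ![φ, 0, -1], ![0, 1, -φ], ![-φ, 0, -1], ![0, -1, -φ]]

/-- Outward normals of the twelve faces of the right-angled hyperbolic dodecahedron. Two axes of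
contiguous faces have Euclidean inner product `φ`, so the last coordinate `√φ` makes the normals
of contiguous faces orthogonal: all dihedral angles are right angles. -/
def faceNormal (i : Fin 12) : Mink :=
  ![faceAxis i 0, faceAxis i 1, faceAxis i 2, Real.sqrt Real.goldenRatio]

/-- The right-angled (Poincaré) dodecahedron. -/
def dodecahedron : Set Mink := {x ∈ hyperbolicSpace | ∀ i, form x (faceNormal i) ≤ 0}

/-- The hyperbolic reflection in the plane that carries face `i` of the dodecahedron. -/
def reflect (i : Fin 12) (x : Mink) : Mink :=
  x - (2 * form x (faceNormal i) / form (faceNormal i) (faceNormal i)) • faceNormal i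

/-- Composition of reflections along a word. If `place w` carries the dodecahedron onto a tile `T`,
then `place (w ++ [i])` carries it onto the mirror image of `T` in the face of `T` that is
the image of face `i` under `place w`. -/
def place : List (Fin 12) → Mink → Mink
  | [] => id
  | i :: w => reflect i ∘ place w

/-- The tiles of the dodecagrid: the dodecahedron and all sets obtained from it by successively
reflecting a tile in one of its faces. -/
def Tile : Type := {T : Set Mink // ∃ w : List (Fin 12), place w '' dodecahedron = T}

/-- The tile reached from the initial dodecahedron along the word `w`: cross face `w₀`, then
the face which is the copy of face `w₁`, and so on. -/
def tile (w : List (Fin 12)) : Tile := ⟨place w '' dodecahedron, w, rfl⟩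

/-- The permutation of the faces induced by the reflection of the dodecahedron in the plane
`x₀ = 0`. -/
def mirror : Fin 12 → Fin 12 := ![0, 1, 5, 4, 3, 2, 7, 6, 10, 9, 8, 11]

/-- The numbering of the faces of `tile w`: number `i` is given to the image under `place w` of
face `numbering w i` of the dodecahedron. When `place w` reverses the orientation it is
first composed with a mirror symmetry, so that the numbering of each tile is the one of
the initial dodecahedron carried by a displacement (an orientation preserving isometry). -/
def numbering (w : List (Fin 12)) (i : Fin 12) : Fin 12 :=
  if Even w.length then i else mirror i

/-- The `i`-neighbour of `tile w`: the tile that shares with it the face with number `i`. -/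
def neighbour (w : List (Fin 12)) (i : Fin 12) : Tile := tile (w ++ [numbering w i])

/-- The ball of radius `k` around `T₀` for the distance that counts steps from a tile
to a tile that shares a face with it. -/
def ball (T₀ : Tile) (k : ℕ) : Set Tile :=
  {T | ∃ w u : List (Fin 12), tile w = T₀ ∧ tile (w ++ u) = T ∧ u.length ≤ k}

/-! ## Rules and rotations -/

/-- The alphabet; `W` (white) is the blank. -/
inductive State : Type
  | W | B | R | G | Y
  deriving DecidableEq

/-- Numbering of the alphabet, used to encode states as input data. -/
def State.equivFin : State ≃ Fin 5 where
  toFun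
    | .W => 0 | .B => 1 | .R => 2 | .G => 3 | .Y => 4
  invFun := ![.W, .B, .R, .G, .Y]
  left_inv s := by cases s <;> rfl
  right_inv i := by fin_cases i <;> rfl

instance : Fintype State := Fintype.ofEquiv (Fin 5) State.equivFin.symm

instance : Primcodable State := Primcodable.ofEquiv (Fin 5) State.equivFin

/-- A rule: the current state of a cell, the states of its `i`-neighbours, its new state. -/
@[ext] structure Rule where
  old : State
  nbr : Fin 12 → State
  new : State

/-- The permutations of the faces induced by the rotations leaving the dodecahedron invariant. -/
def IsRotation (ρ : Equiv.Perm (Fin 12)) : Prop :=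
  ∃ M ∈ Matrix.specialOrthogonalGroup (Fin 3) ℝ,
    ∀ i, Matrix.mulVec M (faceAxis i) = faceAxis (ρ i)

/-- The rotated image of a rule under a permutation of the faces. -/
def Rule.rotate (S : Rule) (ρ : Equiv.Perm (Fin 12)) : Rule := ⟨S.old, S.nbr ∘ ρ, S.new⟩

/-- All rotated forms of the rules of a set. -/
def rotatedForms (P : Set Rule) : Set Rule := {S | ∃ U ∈ P, ∃ ρ, IsRotation ρ ∧ U.rotate ρ = S}

/-- Two rules are rotationally independent if neither is a rotated form of the other, that is, if
their sets of rotated forms differ. -/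
def RotationallyIndependent (U V : Rule) : Prop := rotatedForms {U} ≠ rotatedForms {V}

/-- The distinct rules of the set are pairwise rotationally independent. -/
def RotationallyCoherent (P : Set Rule) : Prop := P.Pairwise RotationallyIndependent

/-- A (rotation invariant) cellular automaton on the dodecagrid, given by its program. The rules of
the program and their rotated forms are the rules that are applied to the cells;
they never prescribe two new states for the same state and neighbourhood. Not every
neighbourhood needs to be covered by a rule. -/
structure Automaton where
  program : Set Rule
  functional : ∀ U ∈ rotatedForms program, ∀ V ∈ rotatedForms program,
    U.old = V.old → U.nbr = V.nbr → U.new = V.new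

/-- The rule that keeps a blank cell blank when its neighbours `0`, `1`, `2` have states
`s`, `t`, `u` and all its other neighbours are blank. -/
def blankRule (s t u : State) : Rule :=
  ⟨.W, ![s, t, u, .W, .W, .W, .W, .W, .W, .W, .W, .W], .W⟩

open State in
/-- The 39 rules that keep a blank cell blank. -/
def blankRules : List Rule :=
  [blankRule W W W, blankRule B W W, blankRule R W W, blankRule G W W, blankRule Y W W,
    blankRule B B W, blankRule G G W, blankRule R R W, blankRule Y Y W, blankRule R B W,
    blankRule R Y W, blankRule G B W, blankRule G R W, blankRule G Y W, blankRule Y B W,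
    blankRule B B B, blankRule R R R, blankRule G G G, blankRule Y Y Y,
    blankRule B B R, blankRule B B G, blankRule B B Y, blankRule R R B, blankRule R R G,
    blankRule R R Y, blankRule G G B, blankRule G G R, blankRule G G Y, blankRule Y Y B,
    blankRule Y Y R, blankRule Y Y G,
    blankRule B R G, blankRule B R Y, blankRule B G R, blankRule B G Y, blankRule B Y R,
    blankRule B Y G, blankRule R G Y, blankRule R Y G]

/-! ## Configurations and computations -/

/-- A configuration assigns a state to each cell. -/
abbrev Config := Tile → State

/-- The set of non-blank cells of a configuration. -/
def nonBlank (c : Config) : Set Tile := {T | c T ≠ State.W}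

/-- The rule `S` matches the cell `T` and its neighbours in the configuration `c`. -/
def Rule.Matches (S : Rule) (c : Config) (T : Tile) : Prop :=
  ∃ w, tile w = T ∧ c T = S.old ∧ ∀ i, c (neighbour w i) = S.nbr i

/-- One step of the computation: all cells are updated simultaneously, each one by a rule
of the automaton that matches it. -/
def Automaton.Step (A : Automaton) (c c' : Config) : Prop :=
  ∀ T, ∃ S ∈ rotatedForms A.program, S.Matches c T ∧ c' T = S.new

/-- The computation halts if two successive configurations are identical. -/
def Automaton.Halts (A : Automaton) (c : Config) : Prop :=
  ∃ d, Relation.ReflTransGen A.Step c d ∧ A.Step d d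

open Classical in
/-- The finite configuration described by a finite list of cells, given by words, and states. -/
def ofList : List (List (Fin 12) × State) → Config
  | [] => fun _ => State.W
  | (w, s) :: l => Function.update (ofList l) (tile w) s

/-- Each configuration with finitely many non-blank cells is described by some list. -/
theorem exists_ofList (c : Config) (hc : (nonBlank c).Finite) : ∃ l, ofList l = c := by
  classical
  have key : ∀ s : Finset Tile, ∃ l, ofList l = fun T => if T ∈ s then c T else State.W := by
    intro s
    induction s using Finset.induction_on with
    | empty => exact ⟨[], by simp [ofList]⟩
    | insert T s _ ih =>
      obtain ⟨l, hl⟩ := ih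
      obtain ⟨w, hw⟩ : ∃ w, tile w = T := by
        obtain ⟨S, w, rfl⟩ := T
        exact ⟨w, rfl⟩
      refine ⟨(w, c T) :: l, ?_⟩
      funext U
      simp only [ofList, hl, hw, Function.update_apply, Finset.mem_insert]
      by_cases h : U = T <;> simp [h]
  obtain ⟨l, hl⟩ := key hc.toFinset
  refine ⟨l, ?_⟩
  rw [hl]
  funext T
  by_cases h : c T = State.W <;> simp [nonBlank, h]

end

end Dodecagrid

/-!
The reflections in the faces of the right-angled dodecahedron generate a right-angled Coxeter group:
`form_faceNormal_of_adjacent` says that the reflections in faces that share an edge commute, and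
`form_faceNormal_le` that the planes of any other two faces do not meet. Follow the centre of the
dodecahedron under a word of reflections, and let `height i` measure its position with respect to
the plane of face `i`. As long as each reflection moves the point away from the dodecahedron
(`Ascending`), the point lies on no plane of a face, and the sum of its heights over two
non-adjacent faces is negative (`Ascending.height`). So the planes that separate it from the
dodecahedron belong to pairwise adjacent faces, of which there are at most three.

This has two consequences. Each word can be rewritten as an ascending word by cancelling letters
through commutations (`push`, `reduce`), a non-empty ascending word moves the dodecahedron, and
ascending words for the same element have the same length. This solves the word problem
(`tile_eq_tile_iff`) and shows that the numbering of the faces of a tile does not depend on the word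
that leads to it. Secondly, a tile outside of a ball sees the ball through faces that are pairwise
adjacent (`adjacent_of_neighbour_mem_ball`), hence share a vertex.

If all non-blank cells lie in a ball, then a cell outside of it is blank and its non-blank
neighbours are around a vertex. Up to rotation, the `39` blank rules are all the possible
neighbourhoods of this kind (`blank_mem_rotatedForms`), and as the rules never contradict each other
the cell stays blank. So the computation is confined to the ball. Only finitely many configurations
are blank outside of the ball, and a step is a partial function, so that infinite computations are
eventually periodic, and a computation that halts does so within as many steps as there are such
configurations (`halts_iff`). The confined computation is simulated on lists of words and states,
with `reduce` deciding which words lead to the same cell, and this simulation is primitive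
recursive.
-/

namespace Dodecagrid

/-! ### Adjacency of faces and the Gram matrix of the face normals -/

/-- The five faces that share an edge with a given face, in cyclic order. -/
def faceNbrs : Fin 12 → List (Fin 12) :=
  ![[1, 2, 3, 4, 5], [0, 2, 7, 6, 5], [0, 3, 8, 7, 1], [0, 4, 9, 8, 2], [0, 5, 10, 9, 3],
    [0, 1, 6, 10, 4], [11, 10, 5, 1, 7], [11, 6, 1, 2, 8], [11, 7, 2, 3, 9], [11, 8, 3, 4, 10],
    [11, 9, 4, 5, 6], [6, 7, 8, 9, 10]]

/-- Two faces of the dodecahedron are adjacent if they share an edge. -/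
abbrev Adjacent (i j : Fin 12) : Prop := j ∈ faceNbrs i

/-- The rational part of the coordinates of `faceAxis`, which lie in `ℤ[φ]`. -/
def axisRat : Fin 12 → Fin 3 → ℤ :=
  ![![0, 1, 0], ![0, -1, 0], ![0, 0, 1], ![1, 0, 0], ![-1, 0, 0], ![0, 0, 1],
    ![-1, 0, 0], ![1, 0, 0], ![0, 0, -1], ![0, 1, 0], ![0, 0, -1], ![0, -1, 0]]

/-- The coefficient of `φ` in the coordinates of `faceAxis`, which lie in `ℤ[φ]`. -/
def axisGold : Fin 12 → Fin 3 → ℤ :=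
  ![![0, 0, 1], ![0, 0, 1], ![1, 0, 0], ![0, 1, 0], ![0, 1, 0], ![-1, 0, 0],
    ![0, -1, 0], ![0, -1, 0], ![1, 0, 0], ![0, 0, -1], ![-1, 0, 0], ![0, 0, -1]]

theorem faceAxis_eq (i : Fin 12) (k : Fin 3) :
    faceAxis i k = axisRat i k + axisGold i k * Real.goldenRatio := by
  fin_cases i <;> fin_cases k <;> simp [faceAxis, axisRat, axisGold]

/-- The rational part of the Gram matrix of the face normals. -/
def gramRat (i j : Fin 12) : ℤ := ∑ k, (axisRat i k * axisRat j k + axisGold i k * axisGold j k)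

/-- The coefficient of `φ` in the Gram matrix of the face normals. -/
def gramGold (i j : Fin 12) : ℤ :=
  ∑ k, (axisRat i k * axisGold j k + axisGold i k * axisRat j k + axisGold i k * axisGold j k) - 1

theorem form_faceNormal (i j : Fin 12) :
    form (faceNormal i) (faceNormal j) = gramRat i j + gramGold i j * Real.goldenRatio := by
  have h1 := Real.goldenRatio_sq
  have h2 : Real.sqrt Real.goldenRatio * Real.sqrt Real.goldenRatio = Real.goldenRatio :=
    Real.mul_self_sqrt Real.goldenRatio_pos.le
  simp only [form, faceNormal, Matrix.cons_val, h2, gramRat, gramGold, Fin.sum_univ_three,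
    faceAxis_eq]
  push_cast
  linear_combination ((axisGold i 0 : ℝ) * axisGold j 0 + axisGold i 1 * axisGold j 1
    + axisGold i 2 * axisGold j 2) * h1

theorem gram_table : ∀ i j : Fin 12, (i = j ∧ gramRat i j = 2 ∧ gramGold i j = 0) ∨
    (i ≠ j ∧ Adjacent i j ∧ gramRat i j = 0 ∧ gramGold i j = 0) ∨
    (i ≠ j ∧ ¬ Adjacent i j ∧ gramRat i j ≤ 0 ∧ gramGold i j = -2) := by
  decide +kernel

theorem form_faceNormal_self (i : Fin 12) : form (faceNormal i) (faceNormal i) = 2 := by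
  obtain ⟨_, h1, h2⟩ | ⟨h, _⟩ | ⟨h, _⟩ := gram_table i i
  · simp [form_faceNormal, h1, h2]
  · exact absurd rfl h
  · exact absurd rfl h

theorem form_faceNormal_of_adjacent {i j : Fin 12} (hij : Adjacent i j) :
    form (faceNormal i) (faceNormal j) = 0 := by
  obtain ⟨rfl, _⟩ | ⟨_, _, h1, h2⟩ | ⟨_, h, _⟩ := gram_table i j
  · revert i; decide
  · simp [form_faceNormal, h1, h2]
  · exact absurd hij h

theorem form_faceNormal_le {i j : Fin 12} (hne : i ≠ j) (hij : ¬ Adjacent i j) :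
    form (faceNormal i) (faceNormal j) ≤ -2 := by
  obtain ⟨h, _⟩ | ⟨_, h, _⟩ | ⟨_, _, h1, h2⟩ := gram_table i j
  · exact absurd h hne
  · exact absurd h hij
  · have h3 : (gramRat i j : ℝ) ≤ 0 := by exact_mod_cast h1
    rw [form_faceNormal, h2]
    push_cast
    linarith [Real.one_lt_goldenRatio]

theorem Adjacent.symm : ∀ {i j : Fin 12}, Adjacent i j → Adjacent j i := by decide +kernel

/-! ### The reflection group -/

/-- The height of a point over the plane of face `i`: negative on the side of the dodecahedron. -/
noncomputable def height (i : Fin 12) (x : Mink) : ℝ := form x (faceNormal i)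

theorem reflect_eq (i : Fin 12) (x : Mink) : reflect i x = x - height i x • faceNormal i := by
  simp [reflect, form_faceNormal_self, height]

theorem height_reflect (i j : Fin 12) (x : Mink) :
    height j (reflect i x) = height j x - height i x * form (faceNormal i) (faceNormal j) := by
  rw [reflect_eq]
  simp only [height, form, Pi.sub_apply, Pi.smul_apply, smul_eq_mul]
  ring

theorem height_reflect_self (i : Fin 12) (x : Mink) : height i (reflect i x) = -height i x := by
  rw [height_reflect, form_faceNormal_self]; ring

theorem height_reflect_of_adjacent {i j : Fin 12} (hij : Adjacent i j) (x : Mink) :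
    height j (reflect i x) = height j x := by
  rw [height_reflect, form_faceNormal_of_adjacent hij]; ring

/-- Reflecting in a plane above a point lowers every height over a face that is not adjacent. -/
theorem height_reflect_le {i j : Fin 12} (hne : i ≠ j) (hij : ¬ Adjacent i j) {x : Mink}
    (hx : height i x < 0) : height j (reflect i x) ≤ height j x + 2 * height i x := by
  rw [height_reflect]
  nlinarith [form_faceNormal_le hne hij]

@[simp] theorem reflect_reflect (i : Fin 12) (x : Mink) : reflect i (reflect i x) = x := by
  rw [reflect_eq i (reflect i x), height_reflect_self, reflect_eq]
  module

theorem reflect_comm {i j : Fin 12} (hij : Adjacent i j) (x : Mink) :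
    reflect i (reflect j x) = reflect j (reflect i x) := by
  rw [reflect_eq i, reflect_eq j (reflect i x), height_reflect_of_adjacent hij,
    height_reflect_of_adjacent hij.symm, reflect_eq i, reflect_eq j]
  module

@[simp] theorem place_nil (x : Mink) : place [] x = x := rfl

@[simp] theorem place_cons (i : Fin 12) (w : List (Fin 12)) (x : Mink) :
    place (i :: w) x = reflect i (place w x) := rfl

@[simp] theorem place_append (u w : List (Fin 12)) (x : Mink) :
    place (u ++ w) x = place u (place w x) := by
  induction u with
  | nil => rfl
  | cons i u ih => simp [ih]

@[simp] theorem place_reverse_place (w : List (Fin 12)) (x : Mink) :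
    place w.reverse (place w x) = x := by
  induction w generalizing x with
  | nil => rfl
  | cons i w ih => simp [ih]

@[simp] theorem place_place_reverse (w : List (Fin 12)) (x : Mink) :
    place w (place w.reverse x) = x := by
  simpa using place_reverse_place w.reverse x

theorem place_injective (w : List (Fin 12)) : Function.Injective (place w) :=
  Function.LeftInverse.injective (place_reverse_place w)

/-! ### Ascending words and the word problem -/

/-- The centre of the dodecahedron. -/
def centre : Mink := ![0, 0, 0, 1]

theorem height_centre (i : Fin 12) : height i centre < 0 := by
  simp only [height, form, centre, faceNormal, Matrix.cons_val]
  linarith [Real.sqrt_pos.2 Real.goldenRatio_pos]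

theorem centre_mem : centre ∈ dodecahedron := by
  refine ⟨by simp [hyperbolicSpace, form, centre], fun i => (height_centre i).le⟩

/-- A word is ascending if, read from its last letter, each reflection moves the image of the
centre away from the dodecahedron, across the plane of the corresponding face. -/
def Ascending : List (Fin 12) → Prop
  | [] => True
  | i :: u => height i (place u centre) < 0 ∧ Ascending u

/-- The position of the image of the centre under an ascending word relative to the planes of the
faces: it is on none of them, and it is never above two planes of non-adjacent faces. The last
inequality is stronger, which makes the statement inductive. -/
theorem Ascending.height {u : List (Fin 12)} (hu : Ascending u) :
    (∀ i, height i (place u centre) ≠ 0) ∧ ∀ i j, i ≠ j → ¬ Adjacent i j →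
      height i (place u centre) + height j (place u centre) < 0 := by
  induction u with
  | nil => exact ⟨fun i => (height_centre i).ne, fun i j _ _ =>
      add_neg (height_centre i) (height_centre j)⟩
  | cons k u ih =>
    obtain ⟨hk, hu⟩ := hu
    obtain ⟨h0, h2⟩ := ih hu
    simp only [place_cons]
    set x := place u centre
    have hle : ∀ j, j ≠ k → Dodecagrid.height j (reflect k x) ≤ Dodecagrid.height j x := by
      intro j hj
      by_cases h : Adjacent k j
      · exact (height_reflect_of_adjacent h x).le
      · linarith [height_reflect_le hj.symm h hk]
    have hfold : ∀ j, j ≠ k → ¬ Adjacent k j →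
        Dodecagrid.height k (reflect k x) + Dodecagrid.height j (reflect k x) < 0 := by
      intro j hj h
      have := height_reflect_le hj.symm h hk
      have := h2 k j hj.symm h
      rw [height_reflect_self]
      linarith
    constructor
    · intro i
      by_cases hi : i = k
      · subst hi
        rw [height_reflect_self]
        exact neg_ne_zero.2 hk.ne
      · by_cases h : Adjacent k i
        · rw [height_reflect_of_adjacent h]
          exact h0 i
        · have := hfold i hi h
          rw [height_reflect_self] at this
          linarith
    · intro i j hij h
      by_cases hi : i = k
      · subst hi
        exact hfold j (Ne.symm hij) h
      by_cases hj : j = k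
      · subst hj
        have := hfold i hi (fun h' => h h'.symm)
        linarith
      linarith [hle i hi, hle j hj, h2 i j hij h]

/-- The faces whose planes separate the image of the centre from the dodecahedron are pairwise
adjacent. -/
theorem Ascending.adjacent {u : List (Fin 12)} (hu : Ascending u) {i j : Fin 12} (hij : i ≠ j)
    (hi : 0 < Dodecagrid.height i (place u centre))
    (hj : 0 < Dodecagrid.height j (place u centre)) : Adjacent i j := by
  by_contra h
  linarith [hu.height.2 i j hij h]

/-- Multiplication of an ascending word by a generator on the left: the letter travels to the right
through letters of adjacent faces, which commute with it, until it is cancelled or blocked. -/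
def push (i : Fin 12) : List (Fin 12) → List (Fin 12)
  | [] => [i]
  | k :: u => if i = k then u else if Adjacent i k then k :: push i u else i :: k :: u

@[simp] theorem place_push (i : Fin 12) (u : List (Fin 12)) (x : Mink) :
    place (push i u) x = reflect i (place u x) := by
  induction u with
  | nil => rfl
  | cons k u ih =>
    simp only [push]
    split_ifs with h1 h2
    · subst h1; simp
    · simp [ih, reflect_comm h2]
    · rfl

theorem Ascending.push {u : List (Fin 12)} (hu : Ascending u) (i : Fin 12) :
    Ascending (push i u) := by
  induction u with
  | nil => exact ⟨height_centre i, trivial⟩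
  | cons k u ih =>
    simp only [Dodecagrid.push]
    obtain ⟨hk, hu'⟩ := hu
    split_ifs with h1 h2
    · exact hu'
    · refine ⟨?_, ih hu'⟩
      rwa [place_push, height_reflect_of_adjacent h2]
    · refine ⟨?_, hk, hu'⟩
      have h2' : ¬ Adjacent k i := fun h => h2 h.symm
      have := height_reflect_le (Ne.symm h1) h2' hk
      have := hu'.height.2 i k h1 h2
      rw [place_cons]
      linarith

theorem length_push (i : Fin 12) (u : List (Fin 12)) :
    (push i u).length = u.length + 1 ∨ (push i u).length + 1 = u.length := by
  induction u with
  | nil => simp [push]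
  | cons k u ih =>
    simp only [push]
    split_ifs <;> simp
    omega

/-- A letter that descends is cancelled. -/
theorem Ascending.length_push {u : List (Fin 12)} (hu : Ascending u) {i : Fin 12}
    (hi : 0 < Dodecagrid.height i (place u centre)) :
    (Dodecagrid.push i u).length + 1 = u.length := by
  induction u with
  | nil => exact absurd hi (height_centre i).not_gt
  | cons k u ih =>
    obtain ⟨hk, hu'⟩ := hu
    simp only [Dodecagrid.push]
    rw [place_cons] at hi
    split_ifs with h1 h2
    · rfl
    · rw [height_reflect_of_adjacent h2.symm] at hi
      simp [ih hu' hi]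
    · have h2' : ¬ Adjacent k i := fun h => h2 h.symm
      have := height_reflect_le (Ne.symm h1) h2' hk
      have := hu'.height.2 i k h1 h2
      linarith

/-- The length of an ascending word depends only on the image of the centre. -/
theorem Ascending.length_eq {u v : List (Fin 12)} (hu : Ascending u) (hv : Ascending v)
    (h : place u centre = place v centre) : u.length = v.length := by
  induction u generalizing v with
  | nil =>
    cases v with
    | nil => rfl
    | cons k v =>
      have h1 := height_reflect_self k (place v centre)
      rw [← place_cons, ← h] at h1
      have := height_centre k
      have := hv.1
      simp only [place_nil] at h1
      linarith
  | cons i u ih =>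
    have h1 := height_reflect_self i (place u centre)
    rw [← place_cons, h] at h1
    have h2 := hv.length_push (i := i) (by rw [h1]; exact neg_pos.2 hu.1)
    have h3 := ih hu.2 (hv.push i) (by rw [place_push, ← h, place_cons, reflect_reflect])
    simp only [List.length_cons]
    omega

/-- An ascending word with the same action as a given word. -/
def reduce (w : List (Fin 12)) : List (Fin 12) := w.foldr push []

theorem ascending_reduce (w : List (Fin 12)) : Ascending (reduce w) := by
  induction w with
  | nil => trivial
  | cons i w ih => exact ih.push i

@[simp] theorem place_reduce (w : List (Fin 12)) (x : Mink) : place (reduce w) x = place w x := by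
  induction w with
  | nil => rfl
  | cons i w ih => simpa [reduce] using congrArg (reflect i) ih

theorem length_reduce (w : List (Fin 12)) :
    (reduce w).length ≤ w.length ∧ (Even (reduce w).length ↔ Even w.length) := by
  induction w with
  | nil => simp [reduce]
  | cons i w ih =>
    have h := length_push i (reduce w)
    simp only [Nat.even_iff] at ih ⊢
    change (push i (reduce w)).length ≤ _ ∧ ((push i (reduce w)).length % 2 = 0 ↔ _)
    rw [List.length_cons]
    omega

/-- The word problem of the reflection group, which acts freely on the tiles. -/
theorem tile_eq_tile_iff {w w' : List (Fin 12)} :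
    tile w = tile w' ↔ reduce (w.reverse ++ w') = [] := by
  have key : reduce (w.reverse ++ w') = [] → ∀ x, place w x = place w' x := by
    intro h x
    have h1 := place_reduce (w.reverse ++ w') x
    rw [h, place_append, place_nil] at h1
    rw [h1, place_place_reverse, ← h1]
  constructor
  · intro h
    have h1 : place w' centre ∈ place w '' dodecahedron := by
      rw [show place w '' dodecahedron = place w' '' dodecahedron from congrArg Subtype.val h]
      exact ⟨_, centre_mem, rfl⟩
    obtain ⟨y, hy, h1⟩ := h1
    have h2 : place (reduce (w.reverse ++ w')) centre ∈ dodecahedron := by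
      rw [place_reduce, place_append, ← h1, place_reverse_place]
      exact hy
    have h3 := ascending_reduce (w.reverse ++ w')
    generalize reduce (w.reverse ++ w') = u at h2 h3
    cases u with
    | nil => rfl
    | cons i u =>
      have h4 : height i (place (i :: u) centre) ≤ 0 := h2.2 i
      rw [place_cons, height_reflect_self] at h4
      linarith [h3.1]
  · intro h
    have : place w = place w' := funext (key h)
    exact Subtype.ext (by simp [tile, this])

theorem place_eq_of_tile_eq {w w' : List (Fin 12)} (h : tile w = tile w') :
    place w = place w' := by
  funext x
  have h1 := place_reduce (w.reverse ++ w') x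
  rw [tile_eq_tile_iff.1 h, place_append, place_nil] at h1
  rw [h1, place_place_reverse, ← h1]

theorem tile_eq_of_place_eq {w w' : List (Fin 12)} (h : place w = place w') :
    tile w = tile w' :=
  Subtype.ext (by simp [tile, h])

theorem even_length_iff_of_tile_eq {w w' : List (Fin 12)} (h : tile w = tile w') :
    Even w.length ↔ Even w'.length := by
  have h1 := (length_reduce (w.reverse ++ w')).2
  rw [tile_eq_tile_iff.1 h] at h1
  simpa [Nat.even_add] using h1

theorem tile_append_of_tile_eq {w w' : List (Fin 12)} (h : tile w = tile w') (u : List (Fin 12)) :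
    tile (w ++ u) = tile (w' ++ u) :=
  tile_eq_of_place_eq (funext fun x => by simp [place_eq_of_tile_eq h])

/-- The numbering of the faces of a tile does not depend on the word that leads to the tile. -/
theorem neighbour_eq_of_tile_eq {w w' : List (Fin 12)} (h : tile w = tile w') (i : Fin 12) :
    neighbour w i = neighbour w' i := by
  have : numbering w i = numbering w' i := by
    simp [numbering, even_length_iff_of_tile_eq h]
  rw [neighbour, neighbour, this]
  exact tile_append_of_tile_eq h _

/-! ### Balls -/

theorem exists_tile_eq (T : Tile) : ∃ w, tile w = T := by
  obtain ⟨S, w, rfl⟩ := T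
  exact ⟨w, rfl⟩

theorem mem_ball_iff {w : List (Fin 12)} {k : ℕ} {T : Tile} :
    T ∈ ball (tile w) k ↔ ∃ u : List (Fin 12), tile (w ++ u) = T ∧ u.length ≤ k := by
  constructor
  · rintro ⟨w', u, h, rfl, hu⟩
    exact ⟨u, tile_append_of_tile_eq h.symm u, hu⟩
  · rintro ⟨u, rfl, hu⟩
    exact ⟨w, u, rfl, rfl, hu⟩

theorem mirror_adjacent : ∀ {i j : Fin 12}, Adjacent (mirror i) (mirror j) → Adjacent i j := by
  decide +kernel

theorem numbering_adjacent {w : List (Fin 12)} {i j : Fin 12}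
    (h : Adjacent (numbering w i) (numbering w j)) : Adjacent i j := by
  unfold numbering at h
  split_ifs at h
  · exact h
  · exact mirror_adjacent h

theorem mirror_injective : Function.Injective mirror := by
  unfold Function.Injective; decide +kernel

theorem numbering_injective (w : List (Fin 12)) : Function.Injective (numbering w) := by
  intro i j h
  unfold numbering at h
  split_ifs at h
  · exact h
  · exact mirror_injective h

/-- If crossing face `i` leads from a tile outside of a ball into the ball, then the plane
of that face separates the tile from the centre of the ball. -/
theorem height_pos_of_mem_ball {w v : List (Fin 12)} {k : ℕ} {i : Fin 12}
    (hT : tile (w ++ v) ∉ ball (tile w) k) (hi : tile (w ++ v ++ [i]) ∈ ball (tile w) k) :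
    0 < height i (place (reduce v.reverse) centre) := by
  have hr := ascending_reduce v.reverse
  set r := reduce v.reverse with hr_def
  have hlen : k < r.length := by
    by_contra! hle
    refine hT (mem_ball_iff.2 ⟨r.reverse, tile_eq_of_place_eq ?_, by simpa using hle⟩)
    have : ∀ x, place r.reverse x = place v x := fun x => by
      apply place_injective r
      simp [hr_def]
    funext x
    simp [this]
  obtain ⟨u, hu, huk⟩ := mem_ball_iff.1 hi
  by_contra! hneg
  have hasc : Ascending (i :: r) := ⟨lt_of_le_of_ne hneg (hr.height.1 i), hr⟩
  have h1 : ∀ x, place u x = place v (reflect i x) := fun x => by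
    apply place_injective w
    simpa using congrFun (place_eq_of_tile_eq hu) x
  have h2 : place (i :: r) centre = place (reduce u.reverse) centre := by
    rw [place_reduce]
    apply place_injective u
    rw [place_place_reverse, h1]
    simp [hr_def]
  have h3 := hasc.length_eq (ascending_reduce _) h2
  have h4 := (length_reduce u.reverse).1
  simp only [List.length_cons, List.length_reverse] at h3 h4
  omega

/-- The faces through which a tile outside of a ball has neighbours in the ball are pairwise
adjacent. -/
theorem adjacent_of_neighbour_mem_ball {T₀ : Tile} {k : ℕ} {w : List (Fin 12)}
    (hw : tile w ∉ ball T₀ k) {i j : Fin 12} (hij : i ≠ j)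
    (hi : neighbour w i ∈ ball T₀ k) (hj : neighbour w j ∈ ball T₀ k) : Adjacent i j := by
  obtain ⟨w₀, rfl⟩ := exists_tile_eq T₀
  have hv : tile (w₀ ++ (w₀.reverse ++ w)) = tile w :=
    tile_eq_of_place_eq (funext fun x => by simp)
  rw [neighbour, ← tile_append_of_tile_eq hv] at hi hj
  rw [← hv] at hw
  exact numbering_adjacent ((ascending_reduce _).adjacent
    (fun h => hij (numbering_injective w h)) (height_pos_of_mem_ball hw hi)
    (height_pos_of_mem_ball hw hj))

/-! ### Rotations of the dodecahedron -/

theorem IsRotation.mul {ρ τ : Equiv.Perm (Fin 12)} (hρ : IsRotation ρ) (hτ : IsRotation τ) :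
    IsRotation (ρ * τ) := by
  obtain ⟨M, hM, h⟩ := hρ
  obtain ⟨N, hN, h'⟩ := hτ
  exact ⟨M * N, mul_mem hM hN, fun i => by
    rw [← Matrix.mulVec_mulVec, h', h, Equiv.Perm.mul_apply]⟩

theorem isRotation_one : IsRotation 1 := ⟨1, one_mem _, fun i => by simp⟩

theorem IsRotation.pow {ρ : Equiv.Perm (Fin 12)} (hρ : IsRotation ρ) (n : ℕ) :
    IsRotation (ρ ^ n) := by
  induction n with
  | zero => exact isRotation_one
  | succ n ih => exact ih.mul hρ

theorem IsRotation.inv {ρ : Equiv.Perm (Fin 12)} (hρ : IsRotation ρ) : IsRotation ρ⁻¹ := by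
  have h : IsRotation (ρ ^ (orderOf ρ - 1)) := hρ.pow _
  rwa [show ρ⁻¹ = ρ ^ (orderOf ρ - 1) from inv_eq_of_mul_eq_one_right (by
    rw [← pow_succ', Nat.sub_add_cancel (orderOf_pos ρ), pow_orderOf_eq_one])]

/-- The rotation by `2π/5` around the axis of face `0`. -/
def faceTurn : Equiv.Perm (Fin 12) :=
  ⟨![0, 2, 3, 4, 5, 1, 7, 8, 9, 10, 6, 11], ![0, 5, 1, 2, 3, 4, 10, 6, 7, 8, 9, 11],
    by decide, by decide⟩

/-- The half-turn that exchanges the faces `0` and `1`. -/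
def halfTurn : Equiv.Perm (Fin 12) :=
  ⟨![1, 0, 5, 6, 7, 2, 3, 4, 10, 11, 8, 9], ![1, 0, 5, 6, 7, 2, 3, 4, 10, 11, 8, 9],
    by decide, by decide⟩

theorem isRotation_halfTurn : IsRotation halfTurn := by
  refine ⟨!![-1, 0, 0; 0, -1, 0; 0, 0, 1], ?_, fun i => ?_⟩
  · rw [Matrix.mem_specialOrthogonalGroup_iff, Matrix.mem_orthogonalGroup_iff]
    constructor
    · ext i j
      fin_cases i <;> fin_cases j <;> simp [Matrix.mul_apply, Fin.sum_univ_three]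
    · simp [Matrix.det_fin_three]
  · funext k
    fin_cases i <;> fin_cases k <;>
      simp [faceAxis, halfTurn, Matrix.mulVec, dotProduct, Fin.sum_univ_three]

theorem isRotation_faceTurn : IsRotation faceTurn := by
  have h := Real.goldenRatio_sq
  set φ := Real.goldenRatio with hφ
  refine ⟨!![(φ - 1) / 2, -φ / 2, 1 / 2; φ / 2, 1 / 2, (φ - 1) / 2; -1 / 2, (φ - 1) / 2, φ / 2],
    ?_, fun i => ?_⟩
  · rw [Matrix.mem_specialOrthogonalGroup_iff, Matrix.mem_orthogonalGroup_iff]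
    constructor
    · ext i j
      fin_cases i <;> fin_cases j <;>
        simp only [Matrix.mul_apply, Fin.sum_univ_three, Matrix.transpose_apply,
          Matrix.of_apply, Matrix.cons_val, Fin.mk_one, Fin.zero_eta, Fin.reduceFinMk,
          Matrix.one_apply_eq, ne_eq, Fin.reduceEq, not_false_eq_true, Matrix.one_apply_ne] <;>
        nlinarith
    · simp only [Matrix.det_fin_three, Matrix.of_apply, Matrix.cons_val]
      linear_combination (3 / 4 : ℝ) * h
  · funext k
    fin_cases i <;> fin_cases k <;>
      simp only [faceAxis, faceTurn, Matrix.mulVec, dotProduct, Fin.sum_univ_three,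
        Matrix.of_apply, Matrix.cons_val, Fin.mk_one, Fin.zero_eta, Fin.reduceFinMk,
        Equiv.coe_fn_mk, ← hφ] <;>
      nlinarith

/-- A family of rotations that carry the vertex between the faces `0`, `1`, `2` to all vertices
of the dodecahedron. -/
def turn (i j l : Fin 5) : Equiv.Perm (Fin 12) :=
  faceTurn ^ (i : ℕ) * halfTurn * faceTurn ^ (j : ℕ) * halfTurn * faceTurn ^ (l : ℕ)

theorem isRotation_turn (i j l : Fin 5) : IsRotation (turn i j l) :=
  ((((isRotation_faceTurn.pow _).mul isRotation_halfTurn).mul (isRotation_faceTurn.pow _)).mul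
    isRotation_halfTurn).mul (isRotation_faceTurn.pow _)

/-- Pairwise adjacent or equal faces `a`, `b`, `c` are among the images of `0`, `1`, `2` under some
rotation of the family. -/
theorem exists_turn_of_adjacent : ∀ a b : Fin 12, (a = b ∨ Adjacent a b) →
    ∀ c, (a = c ∨ Adjacent a c) → (b = c ∨ Adjacent b c) → ∃ i j l,
      (turn i j l).symm a ≤ 2 ∧ (turn i j l).symm b ≤ 2 ∧ (turn i j l).symm c ≤ 2 := by
  decide +kernel

/-- No four faces are pairwise adjacent. -/
theorem mem_triple_of_adjacent : ∀ a b : Fin 12, Adjacent a b → ∀ c, Adjacent a c → Adjacent b c →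
    ∀ d, (a = d ∨ Adjacent a d) → (b = d ∨ Adjacent b d) → (c = d ∨ Adjacent c d) →
      d = a ∨ d = b ∨ d = c := by
  decide +kernel

/-- Pairwise adjacent faces share a vertex. -/
theorem exists_triple_of_clique {p : Fin 12 → Prop}
    (hp : ∀ i j, i ≠ j → p i → p j → Adjacent i j) :
    ∃ a b c : Fin 12, (a = b ∨ Adjacent a b) ∧ (a = c ∨ Adjacent a c) ∧ (b = c ∨ Adjacent b c) ∧
      ∀ d, p d → d = a ∨ d = b ∨ d = c := by
  have hp' : ∀ i j, p i → p j → i = j ∨ Adjacent i j := fun i j hi hj =>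
    or_iff_not_imp_left.2 fun h => hp i j h hi hj
  by_cases ha : ∃ a, p a
  swap
  · exact ⟨0, 0, 0, .inl rfl, .inl rfl, .inl rfl, fun d hd => absurd ⟨d, hd⟩ ha⟩
  obtain ⟨a, ha⟩ := ha
  by_cases hb : ∃ b, p b ∧ a ≠ b
  swap
  · push Not at hb
    exact ⟨a, a, a, .inl rfl, .inl rfl, .inl rfl, fun d hd => .inl (hb d hd).symm⟩
  obtain ⟨b, hb, hab⟩ := hb
  by_cases hc : ∃ c, p c ∧ a ≠ c ∧ b ≠ c
  swap
  · push Not at hc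
    refine ⟨a, b, b, hp' a b ha hb, hp' a b ha hb, .inl rfl, fun d hd => ?_⟩
    by_cases h : a = d
    · exact .inl h.symm
    · exact .inr (.inl (hc d hd h).symm)
  obtain ⟨c, hc, hac, hbc⟩ := hc
  exact ⟨a, b, c, hp' a b ha hb, hp' a c ha hc, hp' b c hb hc, fun d hd =>
    mem_triple_of_adjacent a b (hp a b hab ha hb) c (hp a c hac ha hc) (hp b c hbc hb hc) d
      (hp' a d ha hd) (hp' b d hb hd) (hp' c d hc hd)⟩

/-! ### The blank rules cover all neighbourhoods around a vertex -/

theorem rotate_mem_rotatedForms {P : Set Rule} {S : Rule} (hS : S ∈ rotatedForms P)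
    {ρ : Equiv.Perm (Fin 12)} (hρ : IsRotation ρ) : S.rotate ρ ∈ rotatedForms P := by
  obtain ⟨U, hU, τ, hτ, rfl⟩ := hS
  exact ⟨U, hU, τ * ρ, hτ.mul hρ, rfl⟩

/-- The rotation around the vertex between the faces `0`, `1`, `2` permutes their states. -/
theorem blankRule_rotate_vertex (s t u : State) :
    (blankRule s t u).rotate (faceTurn * halfTurn) = blankRule u s t := by
  refine Rule.ext rfl ?_ rfl
  funext i
  fin_cases i <;> rfl

theorem blankRule_rotate_halfTurn (s t : State) :
    (blankRule s t .W).rotate halfTurn = blankRule t s .W := by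
  refine Rule.ext rfl ?_ rfl
  funext i
  fin_cases i <;> rfl

theorem eq_blankRule_of_mem {U : Rule} (hU : U ∈ blankRules) :
    U = blankRule (U.nbr 0) (U.nbr 1) (U.nbr 2) := by
  simp only [blankRules, List.mem_cons, List.not_mem_nil, or_false] at hU
  rcases hU with rfl | rfl | rfl | rfl | rfl | rfl | rfl | rfl | rfl | rfl | rfl | rfl | rfl |
    rfl | rfl | rfl | rfl | rfl | rfl | rfl | rfl | rfl | rfl | rfl | rfl | rfl | rfl | rfl |
    rfl | rfl | rfl | rfl | rfl | rfl | rfl | rfl | rfl | rfl | rfl <;> rfl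

/-- Some blank rule has the states `s`, `t`, `u` at the faces `0`, `1`, `2`. -/
def IsListed (s t u : State) : Prop :=
  ∃ U ∈ blankRules, U.nbr 0 = s ∧ U.nbr 1 = t ∧ U.nbr 2 = u

instance (s t u : State) : Decidable (IsListed s t u) :=
  inferInstanceAs (Decidable (∃ U ∈ blankRules, _))

/-- Three states around a vertex are listed up to a cyclic permutation, and up to a transposition
if one of them is blank, since then the half-turn around the edge of the other two faces exchanges
these. -/
theorem isListed_or : ∀ s t u : State,
    IsListed s t u ∨ IsListed t u s ∨ IsListed u s t ∨ (u = .W ∧ IsListed t s .W) ∨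
      (s = .W ∧ IsListed u t .W) ∨ (t = .W ∧ IsListed s u .W) := by
  decide +kernel

theorem blankRule_mem_rotatedForms {P : Set Rule}
    (hP : ∀ S ∈ blankRules, S ∈ rotatedForms P) (s t u : State) :
    blankRule s t u ∈ rotatedForms P := by
  have h1 : ∀ {s t u}, IsListed s t u → blankRule s t u ∈ rotatedForms P := by
    rintro s t u ⟨U, hU, rfl, rfl, rfl⟩
    rw [← eq_blankRule_of_mem hU]
    exact hP U hU
  have h2 : ∀ {s t u}, blankRule s t u ∈ rotatedForms P → blankRule u s t ∈ rotatedForms P := by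
    intro s t u h
    rw [← blankRule_rotate_vertex]
    exact rotate_mem_rotatedForms h (isRotation_faceTurn.mul isRotation_halfTurn)
  have h3 : ∀ {s t}, blankRule s t .W ∈ rotatedForms P → blankRule t s .W ∈ rotatedForms P := by
    intro s t h
    rw [← blankRule_rotate_halfTurn]
    exact rotate_mem_rotatedForms h isRotation_halfTurn
  rcases isListed_or s t u with h | h | h | ⟨rfl, h⟩ | ⟨rfl, h⟩ | ⟨rfl, h⟩
  · exact h1 h
  · exact h2 (h1 h)
  · exact h2 (h2 (h1 h))
  · exact h3 (h1 h)
  · exact h2 (h3 (h1 h))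
  · exact h2 (h2 (h3 (h1 h)))

/-- A blank cell whose non-blank neighbours are behind pairwise adjacent faces is kept blank by a
rotated form of a rule of the program. -/
theorem blank_mem_rotatedForms {P : Set Rule} (hP : ∀ S ∈ blankRules, S ∈ rotatedForms P)
    {f : Fin 12 → State} (hf : ∀ i j, i ≠ j → f i ≠ .W → f j ≠ .W → Adjacent i j) :
    (⟨.W, f, .W⟩ : Rule) ∈ rotatedForms P := by
  obtain ⟨a, b, c, hab, hac, hbc, habc⟩ := exists_triple_of_clique hf
  obtain ⟨i, j, l, ha, hb, hc⟩ := exists_turn_of_adjacent a b hab c hac hbc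
  set ρ := turn i j l with hρ
  have hf' : ∀ x, 2 < x → f (ρ x) = .W := by
    intro x hx
    by_contra h
    rcases habc _ h with h | h | h
    · rw [← h, Equiv.symm_apply_apply] at ha
      exact absurd hx ha.not_gt
    · rw [← h, Equiv.symm_apply_apply] at hb
      exact absurd hx hb.not_gt
    · rw [← h, Equiv.symm_apply_apply] at hc
      exact absurd hx hc.not_gt
  have h : (⟨.W, f, .W⟩ : Rule) = (blankRule (f (ρ 0)) (f (ρ 1)) (f (ρ 2))).rotate ρ⁻¹ := by
    refine Rule.ext rfl ?_ rfl
    have : f ∘ ρ = (blankRule (f (ρ 0)) (f (ρ 1)) (f (ρ 2))).nbr := by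
      funext x
      by_cases hx : 2 < x
      · rw [Function.comp_apply, hf' x hx]
        revert hx
        fin_cases x <;> first | (intro; rfl) | (intro h; exact absurd h (by decide))
      · revert hx
        fin_cases x <;> first | (intro; rfl) | (intro h; exact absurd (by decide) h)
    change f = (blankRule (f (ρ 0)) (f (ρ 1)) (f (ρ 2))).nbr ∘ ⇑ρ⁻¹
    rw [← this]
    funext x
    simp
  rw [h]
  exact rotate_mem_rotatedForms (blankRule_mem_rotatedForms hP _ _ _) (isRotation_turn i j l).inv

/-! ### The local rule and the confinement to balls -/

/-- The neighbourhood of the tile reached along a word, in a given configuration. -/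
def nbhd (c : Config) (w : List (Fin 12)) (i : Fin 12) : State := c (neighbour w i)

open Classical in
/-- The new state that the program of an automaton prescribes for a state and a neighbourhood,
or `none` if no rule applies. -/
noncomputable def Automaton.localRule (A : Automaton) (p : State × (Fin 12 → State)) : Option State :=
  if h : ∃ s, (⟨p.1, p.2, s⟩ : Rule) ∈ rotatedForms A.program then some h.choose else none

theorem Automaton.localRule_eq_some_iff (A : Automaton) {s t : State} {f : Fin 12 → State} :
    A.localRule (s, f) = some t ↔ (⟨s, f, t⟩ : Rule) ∈ rotatedForms A.program := by
  unfold Automaton.localRule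
  constructor
  · intro h
    split_ifs at h with h'
    have h2 := h'.choose_spec
    rwa [Option.some.inj h] at h2
  · intro h
    have h' : ∃ s', (⟨s, f, s'⟩ : Rule) ∈ rotatedForms A.program := ⟨t, h⟩
    rw [dif_pos h']
    exact congrArg some (A.functional _ h'.choose_spec _ h rfl rfl)

theorem nbhd_eq_of_tile_eq {w w' : List (Fin 12)} (h : tile w = tile w') (c : Config) :
    nbhd c w = nbhd c w' :=
  funext fun i => congrArg c (neighbour_eq_of_tile_eq h i)

theorem Automaton.step_iff (A : Automaton) {c c' : Config} :
    A.Step c c' ↔ ∀ w, A.localRule (c (tile w), nbhd c w) = some (c' (tile w)) := by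
  constructor
  · intro h w
    obtain ⟨S, hS, ⟨w', hw', h1, h2⟩, h3⟩ := h (tile w)
    rw [A.localRule_eq_some_iff]
    have : nbhd c w = S.nbr := funext fun i => by
      rw [nbhd, neighbour_eq_of_tile_eq hw'.symm, h2]
    rwa [h1, this, h3]
  · intro h T
    obtain ⟨w, rfl⟩ := exists_tile_eq T
    exact ⟨_, A.localRule_eq_some_iff.1 (h w), ⟨w, rfl, rfl, fun i => rfl⟩, rfl⟩

theorem Automaton.Step.unique {A : Automaton} {c d d' : Config} (h : A.Step c d)
    (h' : A.Step c d') : d = d' := by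
  funext T
  obtain ⟨w, rfl⟩ := exists_tile_eq T
  exact Option.some.inj ((A.step_iff.1 h w).symm.trans (A.step_iff.1 h' w))

variable {A : Automaton}

theorem localRule_eq_of_notMem_ball (hA : ∀ S ∈ blankRules, S ∈ rotatedForms A.program)
    {T₀ : Tile} {k : ℕ} {c : Config} (hc : nonBlank c ⊆ ball T₀ k) {w : List (Fin 12)}
    (hw : tile w ∉ ball T₀ k) : A.localRule (c (tile w), nbhd c w) = some .W := by
  have h0 : c (tile w) = .W := by
    by_contra h
    exact hw (hc h)
  rw [A.localRule_eq_some_iff, h0]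
  exact blank_mem_rotatedForms hA fun i j hij hi hj =>
    adjacent_of_neighbour_mem_ball hw hij (hc hi) (hc hj)

theorem nonBlank_subset_of_step (hA : ∀ S ∈ blankRules, S ∈ rotatedForms A.program)
    {T₀ : Tile} {k : ℕ} {c d : Config} (hc : nonBlank c ⊆ ball T₀ k) (h : A.Step c d) :
    nonBlank d ⊆ ball T₀ k := by
  intro T hT
  obtain ⟨w, rfl⟩ := exists_tile_eq T
  by_contra hw
  have h1 := A.step_iff.1 h w
  rw [localRule_eq_of_notMem_ball hA hc hw] at h1
  exact hT (Option.some.inj h1).symm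

theorem nonBlank_subset_of_reachable (hA : ∀ S ∈ blankRules, S ∈ rotatedForms A.program)
    {T₀ : Tile} {k : ℕ} {c d : Config} (hc : nonBlank c ⊆ ball T₀ k)
    (h : Relation.ReflTransGen A.Step c d) : nonBlank d ⊆ ball T₀ k := by
  induction h with
  | refl => exact hc
  | tail _ h ih => exact nonBlank_subset_of_step hA ih h

/-! ### Eventual periodicity -/

theorem finite_ball (T₀ : Tile) (k : ℕ) : (ball T₀ k).Finite := by
  obtain ⟨w, rfl⟩ := exists_tile_eq T₀
  refine ((List.finite_length_le (Fin 12) k).image fun u => tile (w ++ u)).subset ?_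
  intro T hT
  obtain ⟨u, rfl, hu⟩ := mem_ball_iff.1 hT
  exact ⟨u, hu, rfl⟩

theorem exists_subset_ball {s : Set Tile} (hs : s.Finite) : ∃ k, s ⊆ ball (tile []) k := by
  induction s, hs using Set.Finite.induction_on with
  | empty => exact ⟨0, Set.empty_subset _⟩
  | @insert T s _ _ ih =>
    obtain ⟨k, hk⟩ := ih
    obtain ⟨w, rfl⟩ := exists_tile_eq T
    refine ⟨max k w.length, Set.insert_subset (mem_ball_iff.2 ⟨w, rfl, le_max_right _ _⟩) ?_⟩
    intro S hS
    obtain ⟨u, h, hu⟩ := mem_ball_iff.1 (hk hS)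
    exact mem_ball_iff.2 ⟨u, h, hu.trans (le_max_left _ _)⟩

theorem finite_setOf_nonBlank_subset {s : Set Tile} (hs : s.Finite) :
    {c : Config | nonBlank c ⊆ s}.Finite := by
  have := hs.to_subtype
  refine Set.Finite.of_injOn (f := fun c (T : s) => c T) (t := Set.univ)
    (fun _ _ => Set.mem_univ _) ?_ Set.finite_univ
  intro c hc d hd h
  funext T
  by_cases hT : T ∈ s
  · exact congrFun h ⟨T, hT⟩
  · rw [not_not.1 fun h => hT (hc h), not_not.1 fun h => hT (hd h)]

theorem eventually_periodic (hA : ∀ S ∈ blankRules, S ∈ rotatedForms A.program)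
    {C : ℕ → Config} (h0 : (nonBlank (C 0)).Finite) (hC : ∀ n, A.Step (C n) (C (n + 1))) :
    ∃ N p : ℕ, 0 < p ∧ ∀ n, N ≤ n → C (n + p) = C n := by
  obtain ⟨k, hk⟩ := exists_subset_ball h0
  have hball : ∀ n, nonBlank (C n) ⊆ ball (tile []) k := by
    intro n
    induction n with
    | zero => exact hk
    | succ n ih => exact nonBlank_subset_of_step hA ih (hC n)
  have hfin := finite_setOf_nonBlank_subset (finite_ball (tile []) k)
  obtain ⟨m, -, n, -, hmn, h⟩ := Set.infinite_univ.exists_lt_map_eq_of_mapsTo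
    (f := C) (fun n _ => hball n) hfin
  refine ⟨m, n - m, by omega, fun j hj => ?_⟩
  induction j, hj using Nat.le_induction with
  | base => rw [h]; congr 1; omega
  | succ j hj ih =>
    have h1 := hC (j + (n - m))
    rw [ih] at h1
    rw [(hC j).unique h1]
    congr 1
    omega

/-! ### Simulation on lists -/

/-- The state of the cell `tile w` in the configuration `ofList l`. -/
def lookup (l : List (List (Fin 12) × State)) (w : List (Fin 12)) : State :=
  l.foldr (fun p s => if reduce (p.1.reverse ++ w) = [] then p.2 else s) .W

theorem ofList_tile (l : List (List (Fin 12) × State)) (w : List (Fin 12)) :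
    ofList l (tile w) = lookup l w := by
  induction l with
  | nil => rfl
  | cons p l ih =>
    obtain ⟨v, s⟩ := p
    simp only [ofList, lookup, List.foldr_cons, Function.update_apply]
    by_cases h : tile w = tile v
    · rw [if_pos h, if_pos (tile_eq_tile_iff.1 h.symm)]
    · rw [if_neg h, if_neg fun h' => h (tile_eq_tile_iff.2 h').symm]
      exact ih

/-- A radius of a ball around the initial tile that contains all cells of a list. -/
def radius (l : List (List (Fin 12) × State)) : ℕ := l.foldr (fun p n => max p.1.length n) 0

theorem length_le_radius {l : List (List (Fin 12) × State)} {p : List (Fin 12) × State}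
    (hp : p ∈ l) : p.1.length ≤ radius l := by
  induction l with
  | nil => simp at hp
  | cons q l ih =>
    rcases List.mem_cons.1 hp with rfl | hp
    · exact le_max_left _ _
    · exact (ih hp).trans (le_max_right _ _)

theorem nonBlank_ofList (l : List (List (Fin 12) × State)) :
    nonBlank (ofList l) ⊆ ball (tile []) (radius l) := by
  suffices h : ∀ T ∈ nonBlank (ofList l), ∃ p ∈ l, tile p.1 = T by
    intro T hT
    obtain ⟨p, hp, rfl⟩ := h T hT
    exact mem_ball_iff.2 ⟨p.1, rfl, length_le_radius hp⟩
  induction l with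
  | nil => intro T hT; exact absurd rfl hT
  | cons p l ih =>
    intro T hT
    by_cases h : T = tile p.1
    · exact ⟨p, List.mem_cons_self, h.symm⟩
    · have : T ∈ nonBlank (ofList l) := by
        simpa [nonBlank, ofList, Function.update_apply, h] using hT
      obtain ⟨q, hq, hqT⟩ := ih T this
      exact ⟨q, List.mem_cons_of_mem _ hq, hqT⟩

/-- All words of length at most `k`. -/
def words : ℕ → List (List (Fin 12))
  | 0 => [[]]
  | k + 1 => [] :: (words k).flatMap fun w => (List.finRange 12).map (· :: w)

theorem mem_words {k : ℕ} {w : List (Fin 12)} : w ∈ words k ↔ w.length ≤ k := by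
  induction k generalizing w with
  | zero => simp [words]
  | succ k ih => cases w <;> simp [words, ih]

/-- The list of the states of the cells reached along the words of a list. -/
def record (V : List (List (Fin 12))) (c : Config) : List (List (Fin 12) × State) :=
  V.map fun w => (w, c (tile w))

theorem ofList_record (V : List (List (Fin 12))) (c : Config) (T : Tile) :
    (∃ w ∈ V, tile w = T) ∧ ofList (record V c) T = c T ∨
      (¬ ∃ w ∈ V, tile w = T) ∧ ofList (record V c) T = .W := by
  induction V with
  | nil => exact .inr ⟨by simp, rfl⟩
  | cons w V ih =>
    simp only [record, List.map_cons, ofList, Function.update_apply, List.mem_cons,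
      exists_eq_or_imp] at ih ⊢
    by_cases h : T = tile w
    · exact .inl ⟨.inl h.symm, by rw [if_pos h, h]⟩
    · simpa only [if_neg h, Ne.symm h, false_or] using ih

/-- A configuration that is blank outside of a ball around the initial tile is determined by its
record on the words that describe the cells of this ball. -/
theorem ofList_record_words {k : ℕ} {c : Config} (hc : nonBlank c ⊆ ball (tile []) k) :
    ofList (record (words k) c) = c := by
  funext T
  obtain ⟨-, h⟩ | ⟨h, h'⟩ := ofList_record (words k) c T
  · exact h
  · rw [h']
    by_contra hT
    obtain ⟨u, hu, huk⟩ := mem_ball_iff.1 (hc (Ne.symm hT))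
    exact h ⟨u, mem_words.2 huk, hu⟩

theorem lookup_record {k : ℕ} {c : Config} (hc : nonBlank c ⊆ ball (tile []) k)
    (w : List (Fin 12)) : lookup (record (words k) c) w = c (tile w) := by
  rw [← ofList_tile, ofList_record_words hc]

/-- The new state of the cell `tile w` in the configuration `ofList l`. -/
noncomputable def Automaton.simLocal (A : Automaton) (l : List (List (Fin 12) × State))
    (w : List (Fin 12)) : Option State :=
  A.localRule (lookup l w, fun i => lookup l (w ++ [numbering w i]))

/-- One step of the computation on the cells reached along the words of a list. -/
noncomputable def Automaton.simStep (A : Automaton) (V : List (List (Fin 12)))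
    (l : List (List (Fin 12) × State)) : Option (List (List (Fin 12) × State)) :=
  if ∀ w ∈ V, A.simLocal l w ≠ none then some (V.map fun w => (w, (A.simLocal l w).getD .W))
  else none

theorem simLocal_record {k : ℕ} {c : Config} (hc : nonBlank c ⊆ ball (tile []) k)
    (w : List (Fin 12)) :
    A.simLocal (record (words k) c) w = A.localRule (c (tile w), nbhd c w) := by
  simp only [Automaton.simLocal, lookup_record hc]
  rfl

theorem simStep_record_of_step {k : ℕ} {c d : Config} (hc : nonBlank c ⊆ ball (tile []) k)
    (h : A.Step c d) : A.simStep (words k) (record (words k) c) = some (record (words k) d) := by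
  rw [A.step_iff] at h
  simp only [Automaton.simStep, simLocal_record hc, h]
  simp [record]

theorem step_of_simStep_record (hA : ∀ S ∈ blankRules, S ∈ rotatedForms A.program)
    {k : ℕ} {c : Config} (hc : nonBlank c ⊆ ball (tile []) k)
    {l : List (List (Fin 12) × State)}
    (h : A.simStep (words k) (record (words k) c) = some l) :
    ∃ d, A.Step c d ∧ l = record (words k) d := by
  choose word hword using exists_tile_eq
  have hlocal : ∀ w, A.localRule (c (tile w), nbhd c (word (tile w))) =
      A.localRule (c (tile w), nbhd c w) := fun w => by
    rw [nbhd_eq_of_tile_eq (hword (tile w))]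
  simp only [Automaton.simStep, simLocal_record hc] at h
  split_ifs at h with hV
  refine ⟨fun T => (A.localRule (c T, nbhd c (word T))).getD .W, ?_, ?_⟩
  · rw [A.step_iff]
    intro w
    rw [hlocal]
    by_cases hw : tile w ∈ ball (tile []) k
    · obtain ⟨u, hu, huk⟩ := mem_ball_iff.1 hw
      rw [List.nil_append] at hu
      have := hV u (mem_words.2 huk)
      rw [nbhd_eq_of_tile_eq hu, hu] at this
      obtain ⟨s, hs⟩ := Option.ne_none_iff_exists'.1 this
      rw [hs, Option.getD_some]
    · rw [localRule_eq_of_notMem_ball hA hc hw, Option.getD_some]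
  · simp only [record, hlocal]
    exact (Option.some.inj h).symm

/-- If an orbit of `f` whose elements are distinguished by finitely many labels reaches a fixed
point, then it does so after a number of steps bounded by the number of labels. -/
theorem iterate_card_eq_of_fixed {α β : Type*} [Fintype β] {f : α → α} {x : α} (φ : α → β)
    (hφ : ∀ m n, φ (f^[m] x) = φ (f^[n] x) → f^[m] x = f^[n] x)
    {n : ℕ} (hn : f (f^[n] x) = f^[n] x) : f^[Fintype.card β] x = f^[n] x := by
  classical
  have hstay : ∀ m, f (f^[m] x) = f^[m] x → ∀ j, m ≤ j → f^[j] x = f^[m] x := by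
    intro m hm j hj
    induction j, hj using Nat.le_induction with
    | base => rfl
    | succ j _ ih => rw [Function.iterate_succ_apply', ih, hm]
  have hex : ∃ m, f (f^[m] x) = f^[m] x := ⟨n, hn⟩
  have hle : Nat.find hex ≤ Fintype.card β := by
    by_contra! hlt
    obtain ⟨i, j, hij, h⟩ := Fintype.exists_ne_map_eq_of_card_lt
      (fun i : Fin (Fintype.card β + 1) => φ (f^[i] x)) (by simp)
    wlog hlt' : i < j generalizing i j
    · exact this j i hij.symm h.symm (lt_of_le_of_ne (not_lt.1 hlt') hij.symm)
    have hj : (j : ℕ) ≤ Nat.find hex := by omega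
    have hij' : (i : ℕ) < j := hlt'
    -- deleting the cycle from `i` to `j` leads to the fixed point in fewer steps
    refine Nat.find_min hex (m := Nat.find hex - j + i) (by omega) ?_
    rw [Function.iterate_add_apply, hφ _ _ h, ← Function.iterate_add_apply, Nat.sub_add_cancel hj]
    exact Nat.find_spec hex
  rw [hstay _ (Nat.find_spec hex) _ hle, hstay _ (Nat.find_spec hex) n (Nat.find_min' hex hn)]

/-- One step of the simulation, where `none` stands for a computation that got stuck. -/
noncomputable def Automaton.simNext (A : Automaton) (V : List (List (Fin 12)))
    (o : Option (List (List (Fin 12) × State))) : Option (List (List (Fin 12) × State)) :=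
  o.bind (A.simStep V)

theorem exists_of_iterate_simNext (hA : ∀ S ∈ blankRules, S ∈ rotatedForms A.program)
    {k : ℕ} {c : Config} (hc : nonBlank c ⊆ ball (tile []) k) {n : ℕ}
    {l : List (List (Fin 12) × State)}
    (h : (A.simNext (words k))^[n] (some (record (words k) c)) = some l) :
    ∃ d, Relation.ReflTransGen A.Step c d ∧ l = record (words k) d := by
  induction n generalizing l with
  | zero => exact ⟨c, .refl, (Option.some.inj h).symm⟩
  | succ n ih =>
    rw [Function.iterate_succ_apply'] at h
    obtain ⟨l', hl', h⟩ := Option.bind_eq_some_iff.1 h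
    obtain ⟨d, hd, rfl⟩ := ih hl'
    obtain ⟨e, he, rfl⟩ :=
      step_of_simStep_record hA (nonBlank_subset_of_reachable hA hc hd) h
    exact ⟨e, hd.tail he, rfl⟩

theorem exists_iterate_simNext (hA : ∀ S ∈ blankRules, S ∈ rotatedForms A.program)
    {k : ℕ} {c d : Config} (hc : nonBlank c ⊆ ball (tile []) k)
    (h : Relation.ReflTransGen A.Step c d) :
    ∃ n, (A.simNext (words k))^[n] (some (record (words k) c)) = some (record (words k) d) := by
  induction h with
  | refl => exact ⟨0, rfl⟩
  | tail hd he ih =>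
    obtain ⟨n, hn⟩ := ih
    refine ⟨n + 1, ?_⟩
    rw [Function.iterate_succ_apply', hn]
    exact simStep_record_of_step (nonBlank_subset_of_reachable hA hc hd) he

theorem card_state : Fintype.card State = 5 := rfl

/-- Halting shows within as many steps as there are configurations in the ball, one more for a
computation that gets stuck. -/
theorem halts_iff (hA : ∀ S ∈ blankRules, S ∈ rotatedForms A.program)
    {k : ℕ} {c : Config} (hc : nonBlank c ⊆ ball (tile []) k) :
    A.Halts c ↔ ∃ l, (A.simNext (words k))^[5 ^ (words k).length + 1]
      (some (record (words k) c)) = some l ∧ A.simStep (words k) l = some l := by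
  constructor
  · rintro ⟨d, hd, hdd⟩
    obtain ⟨n, hn⟩ := exists_iterate_simNext hA hc hd
    have hfix := simStep_record_of_step (nonBlank_subset_of_reachable hA hc hd) hdd
    refine ⟨_, ?_, hfix⟩
    have hcard : Fintype.card (Option (Fin (words k).length → State)) =
        5 ^ (words k).length + 1 := by
      simp [card_state]
    rw [← hn, ← hcard]
    refine iterate_card_eq_of_fixed
      (fun o => o.map fun l (j : Fin (words k).length) => lookup l (words k)[j]) ?_ ?_
    · intro m m' h
      cases h1 : (A.simNext (words k))^[m] (some (record (words k) c)) with
      | none =>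
        cases h2 : (A.simNext (words k))^[m'] (some (record (words k) c)) with
        | none => rfl
        | some l' => simp [h1, h2] at h
      | some l =>
        cases h2 : (A.simNext (words k))^[m'] (some (record (words k) c)) with
        | none => simp [h1, h2] at h
        | some l' =>
          obtain ⟨e, he, rfl⟩ := exists_of_iterate_simNext hA hc h1
          obtain ⟨e', he', rfl⟩ := exists_of_iterate_simNext hA hc h2
          simp only [h1, h2, Option.map_some, Option.some.injEq,
            lookup_record (nonBlank_subset_of_reachable hA hc he),
            lookup_record (nonBlank_subset_of_reachable hA hc he')] at h
          refine congrArg some (List.map_congr_left fun w hw => ?_)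
          obtain ⟨j, hj, rfl⟩ := List.getElem_of_mem hw
          exact congrArg _ (congrFun h ⟨j, hj⟩)
    · rw [hn]
      exact hfix
  · rintro ⟨l, hl, hfix⟩
    obtain ⟨d, hd, rfl⟩ := exists_of_iterate_simNext hA hc hl
    have hdk := nonBlank_subset_of_reachable hA hc hd
    obtain ⟨e, he, heq⟩ := step_of_simStep_record hA hdk hfix
    have : d = e := by
      rw [← ofList_record_words hdk, heq,
        ofList_record_words (nonBlank_subset_of_step hA hdk he)]
    exact ⟨d, hd, this ▸ he⟩

/-! ### Primitive recursiveness of the simulation -/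

theorem primrec_push : Primrec₂ push := by
  have h : Primrec fun p : Fin 12 × List (Fin 12) =>
      (List.rec [p.1] (fun k u r => if p.1 = k then u else if Adjacent p.1 k then k :: r
        else p.1 :: k :: u) p.2 : List (Fin 12)) := by
    refine Primrec.list_rec (f := fun p : Fin 12 × List (Fin 12) => p.2)
      (g := fun p : Fin 12 × List (Fin 12) => [p.1])
      (h := fun p q => if p.1 = q.1 then q.2.1 else if Adjacent p.1 q.1 then q.1 :: q.2.2
        else p.1 :: q.1 :: q.2.1)
      Primrec.snd (Primrec.list_cons.comp Primrec.fst (Primrec.const [])) ?_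
    have hi : Primrec fun x : (Fin 12 × List (Fin 12)) × Fin 12 × List (Fin 12) × List (Fin 12) =>
      x.1.1 := Primrec.fst.comp Primrec.fst
    have hk : Primrec fun x : (Fin 12 × List (Fin 12)) × Fin 12 × List (Fin 12) × List (Fin 12) =>
      x.2.1 := Primrec.fst.comp Primrec.snd
    have hu : Primrec fun x : (Fin 12 × List (Fin 12)) × Fin 12 × List (Fin 12) × List (Fin 12) =>
      x.2.2.1 := Primrec.fst.comp (Primrec.snd.comp Primrec.snd)
    have hr : Primrec fun x : (Fin 12 × List (Fin 12)) × Fin 12 × List (Fin 12) × List (Fin 12) =>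
      x.2.2.2 := Primrec.snd.comp (Primrec.snd.comp Primrec.snd)
    have hadj : PrimrecPred fun x : Fin 12 × Fin 12 => Adjacent x.1 x.2 :=
      ⟨inferInstance, Primrec.dom_finite _⟩
    exact Primrec.ite (Primrec.eq.comp hi hk) hu
      (Primrec.ite (hadj.comp (hi.pair hk)) (Primrec.list_cons.comp hk hr)
        (Primrec.list_cons.comp hi (Primrec.list_cons.comp hk hu)))
  refine h.of_eq fun p => ?_
  obtain ⟨i, u⟩ := p
  induction u with
  | nil => rfl
  | cons k u ih => simp only [push]; rw [← ih]

theorem primrec_reduce : Primrec reduce :=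
  Primrec.list_foldr Primrec.id (Primrec.const [])
    (primrec_push.comp (Primrec.fst.comp Primrec.snd) (Primrec.snd.comp Primrec.snd)).to₂

theorem primrec_lookup : Primrec₂ lookup := by
  refine Primrec.list_foldr
    (h := fun (x : List (List (Fin 12) × State) × List (Fin 12))
      (y : (List (Fin 12) × State) × State) =>
        if reduce (y.1.1.reverse ++ x.2) = [] then y.1.2 else y.2)
    Primrec.fst (Primrec.const _) ?_
  refine Primrec.ite (Primrec.eq.comp (primrec_reduce.comp (Primrec.list_append.comp
    (Primrec.list_reverse.comp ?_) ?_)) (Primrec.const [])) ?_ ?_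
  · exact Primrec.fst.comp (Primrec.fst.comp Primrec.snd)
  · exact Primrec.snd.comp Primrec.fst
  · exact Primrec.snd.comp (Primrec.fst.comp Primrec.snd)
  · exact Primrec.snd.comp Primrec.snd

theorem primrec_radius : Primrec radius :=
  Primrec.list_foldr Primrec.id (Primrec.const 0)
    (Primrec.nat_max.comp (Primrec.list_length.comp
      (Primrec.fst.comp (Primrec.fst.comp Primrec.snd))) (Primrec.snd.comp Primrec.snd)).to₂

theorem primrec_words : Primrec words := by
  have h : Primrec fun n : ℕ => (Nat.rec [[]] (fun _ V => [] :: V.flatMap fun w =>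
      (List.finRange 12).map (· :: w)) n : List (List (Fin 12))) := by
    refine Primrec.nat_rec₁ _ (Primrec.list_cons.comp (Primrec.const [])
      (Primrec.list_flatMap Primrec.snd ?_))
    exact Primrec.list_map (Primrec.const _)
      (Primrec.list_cons.comp Primrec.snd (Primrec.snd.comp Primrec.fst))
  refine h.of_eq fun n => ?_
  induction n with
  | zero => rfl
  | succ n ih => simp only [words]; rw [← ih]

theorem primrec_numbering : Primrec₂ numbering := by
  have h : Primrec fun x : List (Fin 12) × Fin 12 =>
      if x.1.length % 2 = 0 then x.2 else mirror x.2 :=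
    Primrec.ite (Primrec.eq.comp (Primrec.nat_mod.comp (Primrec.list_length.comp Primrec.fst)
      (Primrec.const 2)) (Primrec.const 0)) Primrec.snd
      ((Primrec.dom_finite mirror).comp Primrec.snd)
  exact h.of_eq fun x => by simp [numbering, Nat.even_iff]

theorem primrec_simLocal (A : Automaton) : Primrec₂ A.simLocal := by
  refine (Primrec.dom_finite A.localRule).comp (Primrec.pair primrec_lookup ?_)
  exact Primrec.fin_curry.2 (primrec_lookup.comp (Primrec.fst.comp Primrec.fst)
    (Primrec.list_append.comp (Primrec.snd.comp Primrec.fst)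
      (Primrec.list_cons.comp (primrec_numbering.comp (Primrec.snd.comp Primrec.fst) Primrec.snd)
        (Primrec.const []))))

theorem primrec_simStep (A : Automaton) : Primrec₂ A.simStep := by
  have hrel : PrimrecRel fun (w : List (Fin 12)) (l : List (List (Fin 12) × State)) =>
      A.simLocal l w ≠ none :=
    (Primrec.eq.comp ((primrec_simLocal A).comp Primrec.snd Primrec.fst) (Primrec.const none)).not
  refine Primrec.ite hrel.forall_mem_list (Primrec.option_some.comp
    (Primrec.list_map Primrec.fst ?_)) (Primrec.const none)
  exact Primrec.snd.pair (Primrec.option_getD.comp ((primrec_simLocal A).comp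
    (Primrec.snd.comp Primrec.fst) Primrec.snd) (Primrec.const State.W))

theorem primrec_simNext (A : Automaton) : Primrec₂ A.simNext :=
  Primrec.option_bind Primrec.snd
    ((primrec_simStep A).comp (Primrec.fst.comp Primrec.fst) Primrec.snd)

theorem primrec_pow : Primrec fun n : ℕ => 5 ^ n := by
  have h : Primrec fun n : ℕ => (Nat.rec 1 (fun _ m => m * 5) n : ℕ) :=
    Primrec.nat_rec₁ _ (Primrec.nat_mul.comp Primrec.snd (Primrec.const 5))
  refine h.of_eq fun n => ?_
  induction n with
  | zero => rfl
  | succ n ih => rw [pow_succ, ← ih]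

theorem computablePred_halts (hA : ∀ S ∈ blankRules, S ∈ rotatedForms A.program) :
    ComputablePred fun l : List (List (Fin 12) × State) => A.Halts (ofList l) := by
  have hV : Primrec fun l : List (List (Fin 12) × State) => words (radius l) :=
    primrec_words.comp primrec_radius
  have hstart : Primrec fun l : List (List (Fin 12) × State) =>
      some (record (words (radius l)) (ofList l)) := by
    simp only [record, ofList_tile]
    exact Primrec.option_some.comp (Primrec.list_map hV
      (Primrec.snd.pair (primrec_lookup.comp Primrec.fst Primrec.snd)))
  have hx : Primrec fun l : List (List (Fin 12) × State) =>
      (A.simNext (words (radius l)))^[5 ^ (words (radius l)).length + 1]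
        (some (record (words (radius l)) (ofList l))) :=
    Primrec.nat_iterate (Primrec.succ.comp (primrec_pow.comp (Primrec.list_length.comp hV)))
      hstart ((primrec_simNext A).comp (hV.comp Primrec.fst) Primrec.snd)
  have hp : PrimrecPred fun l : List (List (Fin 12) × State) =>
      ¬ (A.simNext (words (radius l)))^[5 ^ (words (radius l)).length + 1]
        (some (record (words (radius l)) (ofList l))) = none ∧
      A.simNext (words (radius l)) ((A.simNext (words (radius l)))^[5 ^
        (words (radius l)).length + 1] (some (record (words (radius l)) (ofList l)))) =
      (A.simNext (words (radius l)))^[5 ^ (words (radius l)).length + 1]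
        (some (record (words (radius l)) (ofList l))) :=
    (Primrec.eq.comp hx (Primrec.const none)).not.and
      (Primrec.eq.comp ((primrec_simNext A).comp hV hx) hx)
  refine hp.computablePred.of_eq fun l => ?_
  rw [halts_iff hA (nonBlank_ofList l)]
  cases (A.simNext (words (radius l)))^[5 ^ (words (radius l)).length + 1]
      (some (record (words (radius l)) (ofList l))) with
  | none => simp
  | some a => simp [Automaton.simNext]

end Dodecagrid

theorem mainTheorem2 (A : Dodecagrid.Automaton)
    (hcoh : Dodecagrid.RotationallyCoherent A.program)
    (hrules : ∀ S ∈ Dodecagrid.blankRules, S ∈ Dodecagrid.rotatedForms A.program) :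
    -- halting from a finite configuration is decidable
    ComputablePred (fun l : List (List (Fin 12) × Dodecagrid.State) =>
      A.Halts (Dodecagrid.ofList l)) ∧
    -- the computation never leaves a ball that contains the initial non-blank cells
    (∀ (T₀ : Dodecagrid.Tile) (k : ℕ) (c d : Dodecagrid.Config),
      Dodecagrid.nonBlank c ⊆ Dodecagrid.ball T₀ k → Relation.ReflTransGen A.Step c d →
        Dodecagrid.nonBlank d ⊆ Dodecagrid.ball T₀ k) ∧
    -- every infinite computation from a finite configuration is eventually periodic
    (∀ C : ℕ → Dodecagrid.Config, (Dodecagrid.nonBlank (C 0)).Finite →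
      (∀ n, A.Step (C n) (C (n + 1))) →
        ∃ N p : ℕ, 0 < p ∧ ∀ n, N ≤ n → C (n + p) = C n) :=
  ⟨Dodecagrid.computablePred_halts hrules,
    fun _ _ _ _ hc h => Dodecagrid.nonBlank_subset_of_reachable hrules hc h,
    fun _ h0 hC => Dodecagrid.eventually_periodic hrules h0 hC⟩
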